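/- **Lemma 2.3 (LocProj).** Let $\mathbb{S}^3\subset\mathbb{R}^4$ be the unit sphere with its surface measure $\nu_g$ and geodesic distance $d_g(P,Q)=\angle(P,Q)$, and let $B(P,r)=\{Q\in\mathbb{S}^3: d_g(P,Q)<r\}$. For an integer $q\ge 1$ let $\pi_q$ be the orthogonal projection of $L^2(\mathbb{S}^3)=L^2(\mathbb{S}^3,\nu_g;\mathbb{C})$ onto the space of spherical harmonics of degree $q-1$, i.e. restrictions to $\mathbb{S}^3$ of the homogeneous harmonic polynomials of degree $q-1$ on $\mathbb{R}^4$ (the eigenspace of $-\Delta_{\mathbb{S}^3}+1$ with eigenvalue $q^2$). Then there is a constant $C>0$ such that for every dyadic integer $N\ge 1$ (i.e. $N=2^k$, $k\in\{0,1,2,\dots\}$), every $P\in\mathbb{S}^3$ and every integer $q\ge 1$, $$\big\Vert \mathbf{1}_{B(P,N^{-1})}\,\pi_q\big\Vert_{L^2\to L^2}=\big\Vert \pi_q\big[\mathbf{1}_{B(P,N^{-1})}\,\cdot\,\big]\big\Vert_{L^2\to L^2}\le C\left(N^{-1/2}+q^{-2}\right).$$ -/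

import Mathlib

open MeasureTheory
open scoped ENNReal

noncomputable section

namespace SphereCluster

/-- The unit sphere `S³` of `ℝ⁴`. -/
abbrev S3 : Type := Metric.sphere (0 : EuclideanSpace ℝ (Fin 4)) 1

/-- The surface measure on `S³` (rotation invariant, of total mass `2π²`). -/
def surf : Measure S3 := (volume : Measure (EuclideanSpace ℝ (Fin 4))).toSphere

instance : IsFiniteMeasure surf :=
  inferInstanceAs (IsFiniteMeasure (volume : Measure (EuclideanSpace ℝ (Fin 4))).toSphere)

/-- The complex Hilbert space `L²(S³)`. -/
abbrev L2 : Type := Lp ℂ 2 surf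

/-- The geodesic ball: points `Q` of `S³` whose geodesic distance to `P`, which is the angle
between the rays from the origin through `P` and `Q`, is less than `r`. -/
def geoBall (P : S3) (r : ℝ) : Set S3 :=
  {Q | InnerProductGeometry.angle (P : EuclideanSpace ℝ (Fin 4)) Q < r}

theorem measurableSet_geoBall (P : S3) (r : ℝ) : MeasurableSet (geoBall P r) := by
  have h : Continuous fun Q : S3 =>
      InnerProductGeometry.angle (P : EuclideanSpace ℝ (Fin 4)) Q := by
    unfold InnerProductGeometry.angle
    refine Real.continuous_arccos.comp ?_
    have h1 : ∀ Q : S3, ‖(Q : EuclideanSpace ℝ (Fin 4))‖ = 1 := fun Q => by simp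
    simp only [h1]
    fun_prop
  exact (isOpen_lt h continuous_const).measurableSet

/-- The product `1_A f` of an `L²` function with the indicator function of a measurable set. -/
def indicatorMul (A : Set S3) (hA : MeasurableSet A) (f : L2) : L2 :=
  ((Lp.memLp f).indicator hA).toLp (A.indicator f)

theorem coeFn_indicatorMul (A : Set S3) (hA : MeasurableSet A) (f : L2) :
    indicatorMul A hA f =ᵐ[surf] A.indicator f := by
  have h := (Lp.memLp f).indicator hA
  exact MemLp.coeFn_toLp h

/-- Multiplication by the indicator function of a measurable set, as a bounded operator on
`L²(S³)`. -/
def mulIndicator (A : Set S3) (hA : MeasurableSet A) : L2 →L[ℂ] L2 :=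
  LinearMap.mkContinuous
    { toFun := indicatorMul A hA
      map_add' := fun f g => by
        refine Lp.ext ?_
        filter_upwards [coeFn_indicatorMul A hA (f + g), coeFn_indicatorMul A hA f,
          coeFn_indicatorMul A hA g, Lp.coeFn_add f g,
          Lp.coeFn_add (indicatorMul A hA f) (indicatorMul A hA g)] with x h1 h2 h3 h4 h5
        rw [h5, Pi.add_apply, h1, h2, h3]
        by_cases h : x ∈ A
        · simpa only [Set.indicator_of_mem h, Pi.add_apply] using h4
        · simp only [Set.indicator_of_notMem h, add_zero]
      map_smul' := fun c f => by
        refine Lp.ext ?_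
        filter_upwards [coeFn_indicatorMul A hA (c • f), coeFn_indicatorMul A hA f,
          Lp.coeFn_smul c f, Lp.coeFn_smul c (indicatorMul A hA f)] with x h1 h2 h3 h4
        rw [RingHom.id_apply, h4, Pi.smul_apply, h1, h2]
        by_cases h : x ∈ A
        · simpa only [Set.indicator_of_mem h, Pi.smul_apply] using h3
        · simp only [Set.indicator_of_notMem h, smul_zero] }
    1 (fun f => by
      rw [one_mul]
      refine Lp.norm_le_norm_of_ae_le ?_
      filter_upwards [coeFn_indicatorMul A hA f] with x h1
      exact (congrArg norm h1).trans_le (norm_indicator_le_norm_self _ _))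

theorem mulIndicator_apply (A : Set S3) (hA : MeasurableSet A) (f : L2) :
    mulIndicator A hA f = indicatorMul A hA f := rfl

/-- The operator `f ↦ 1_{B(P, r)} f` on `L²(S³)`. -/
def ballCutoff (P : S3) (r : ℝ) : L2 →L[ℂ] L2 :=
  mulIndicator (geoBall P r) (measurableSet_geoBall P r)

/-- The Laplacian `∑ᵢ ∂ᵢ²` on polynomials in four variables. -/
def polyLaplacian : MvPolynomial (Fin 4) ℂ →ₗ[ℂ] MvPolynomial (Fin 4) ℂ :=
  ∑ i : Fin 4, (MvPolynomial.pderiv i).toLinearMap ∘ₗ (MvPolynomial.pderiv i).toLinearMap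

/-- Restriction of a complex polynomial in four variables to `S³ ⊆ ℝ⁴`. -/
def polyRestrict : MvPolynomial (Fin 4) ℂ →ₗ[ℂ] C(S3, ℂ) where
  toFun p := ⟨fun x => MvPolynomial.eval (fun i => ((x.1 i : ℝ) : ℂ)) p,
    (MvPolynomial.continuous_eval p).comp (by fun_prop)⟩
  map_add' p q := by ext x; simp
  map_smul' c p := by ext x; simp [MvPolynomial.smul_eval]

/-- The harmonic homogeneous polynomials of degree `d` in four variables. -/
def harmonicPoly (d : ℕ) : Submodule ℂ (MvPolynomial (Fin 4) ℂ) :=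
  MvPolynomial.homogeneousSubmodule (Fin 4) ℂ d ⊓ LinearMap.ker polyLaplacian

/-- The spherical harmonics of degree `d` on `S³`, as a subspace of `L²(S³)`: the restrictions
to `S³` of the harmonic homogeneous polynomials of degree `d`. -/
def sphericalHarmonics (d : ℕ) : Submodule ℂ L2 :=
  (harmonicPoly d).map ((ContinuousMap.toLp 2 surf ℂ).toLinearMap ∘ₗ polyRestrict)

instance finiteDimensional_harmonicPoly (d : ℕ) : FiniteDimensional ℂ (harmonicPoly d) := by
  have h : harmonicPoly d ≤ MvPolynomial.restrictTotalDegree (Fin 4) ℂ d := fun p hp =>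
    (MvPolynomial.mem_restrictTotalDegree _ _ _).2
      (MvPolynomial.IsHomogeneous.totalDegree_le ((MvPolynomial.mem_homogeneousSubmodule d p).1 hp.1))
  exact Submodule.finiteDimensional_of_le h

instance finiteDimensional_sphericalHarmonics (d : ℕ) :
    FiniteDimensional ℂ (sphericalHarmonics d) := by
  unfold sphericalHarmonics
  infer_instance

/-- For `q ≥ 1`, the spectral projector `π_q`: the orthogonal projection of `L²(S³)` onto the
space of spherical harmonics of degree `q - 1`, the eigenspace of `-Δ + 1` for the
eigenvalue `q²`. -/
def spectralProj (q : ℕ) : L2 →L[ℂ] L2 := (sphericalHarmonics (q - 1)).starProjection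

end SphereCluster

end

/-! Both operators are self-adjoint, so the two compositions are adjoint to each other and have
equal norm. For q = 1 the trivial bound 1 is absorbed by q⁻² = 1. For q ≥ 2 the stronger bound 4
N^{-1/2} holds: a spherical harmonic f of positive degree has at most a fraction 14r of its L² mass
in a geodesic ball of radius r ≤ 1 (`setIntegral_reEval_sq_le`).

This is a Morawetz-type estimate. Put ρ = ⟪P, x⟫ and X = g(ρ)∇ρ, where ∇ is the gradient on the
sphere. Testing -Δf = μf, μ = (d + 1)(d + 3), against Xf and integrating by parts gives the virial
identity `integral_virial`. For g = r/T, T = √(r² + 1 - ρ), the field has size O(r) and points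
towards P. The coefficient of μf² is then at least 1/2 on the ball and at least -2r elsewhere, while
the gradient and zeroth-order terms lose only O(r). Since ∫|∇f|² = μ∫f² (`integral_gradient_sq`),
the virial identity bounds the mass in the ball by O(r)∫f².

Integration by parts on the sphere comes from rotation invariance: differentiating an integral along
plane rotations gives the divergence theorem for tangential parts of fields on ℝ⁴. Homogeneity
(Euler's identity) and harmonicity of the polynomial replace the intrinsic Laplacian. -/

noncomputable section

namespace SphereCluster

open scoped RealInnerProductSpace Pointwise

/-! ### Rotation invariance of the surface measure -/

/-- The ambient space `ℝ⁴`. -/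
abbrev R4 : Type := EuclideanSpace ℝ (Fin 4)

theorem norm_coe_S3 (x : S3) : ‖(x : R4)‖ = 1 := by simp

theorem sum_sq_S3 (x : S3) : ∑ i, (x : R4) i ^ 2 = 1 := by
  have h := EuclideanSpace.real_norm_sq_eq (x : R4)
  rw [norm_coe_S3] at h
  linarith

theorem integrable_of_continuous {F : S3 → ℝ} (hF : Continuous F) : Integrable F surf :=
  hF.integrable_of_hasCompactSupport (HasCompactSupport.of_compactSpace F)

/-- The homeomorphism of the sphere induced by a linear isometry. -/
def sphereMap (R : R4 ≃ₗᵢ[ℝ] R4) : S3 → S3 := fun x => ⟨R x, by simp⟩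

theorem continuous_sphereMap (R : R4 ≃ₗᵢ[ℝ] R4) : Continuous (sphereMap R) := by
  unfold sphereMap
  fun_prop

theorem measurePreserving_sphereMap (R : R4 ≃ₗᵢ[ℝ] R4) :
    MeasurePreserving (sphereMap R) surf surf := by
  refine ⟨(continuous_sphereMap R).measurable, ?_⟩
  ext s hs
  have hm : MeasurableSet (sphereMap R ⁻¹' s) := (continuous_sphereMap R).measurable hs
  rw [Measure.map_apply (continuous_sphereMap R).measurable hs, surf, Measure.toSphere_apply' _ hs,
    Measure.toSphere_apply' _ hm]
  congr 1
  -- The surface measure of a set is a multiple of the volume of the cone over it; a linear isometry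
  -- commutes with forming cones and preserves volume.
  have h : Set.Ioo (0 : ℝ) 1 • ((fun x : S3 => (x : R4)) '' (sphereMap R ⁻¹' s)) =
      R ⁻¹' (Set.Ioo (0 : ℝ) 1 • ((fun x : S3 => (x : R4)) '' s)) := by
    ext y
    simp only [Set.mem_smul, Set.mem_image, Set.mem_preimage]
    constructor
    · rintro ⟨c, hc, _, ⟨x, hx, rfl⟩, rfl⟩
      exact ⟨c, hc, _, ⟨_, hx, rfl⟩, by simp [sphereMap]⟩
    · rintro ⟨c, hc, _, ⟨x, hx, rfl⟩, hy⟩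
      refine ⟨c, hc, _, ⟨sphereMap R.symm x, ?_, rfl⟩, ?_⟩
      · have : sphereMap R (sphereMap R.symm x) = x := by ext1; simp [sphereMap]
        exact this.symm ▸ hx
      · apply R.injective
        rw [← hy]
        simp [sphereMap]
  have h2 := (R.measurePreserving).measure_preimage_equiv (f := R.toMeasurableEquiv)
    (Set.Ioo (0 : ℝ) 1 • ((fun x : S3 => (x : R4)) '' s))
  rw [h]
  exact h2

theorem integral_comp_isometry (R : R4 ≃ₗᵢ[ℝ] R4) {F : R4 → ℝ}
    (hF : Continuous fun x : S3 => F x) :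
    ∫ x : S3, F (R x) ∂surf = ∫ x : S3, F x ∂surf := by
  have h := measurePreserving_sphereMap R
  conv_rhs => rw [← h.map_eq]
  rw [integral_map h.measurable.aemeasurable hF.aestronglyMeasurable]
  rfl

/-! ### Plane rotations and their infinitesimal action -/

section Rotation

variable (a b : R4)

/-- Rotation by the angle `t` in the plane spanned by the orthonormal vectors `a` and `b`. -/
def rotLin (t : ℝ) : R4 →ₗ[ℝ] R4 where
  toFun x := x + ((Real.cos t - 1) * ⟪a, x⟫ - Real.sin t * ⟪b, x⟫) • a +
    ((Real.cos t - 1) * ⟪b, x⟫ + Real.sin t * ⟪a, x⟫) • b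
  map_add' x y := by
    simp only [inner_add_right]
    module
  map_smul' c x := by
    simp only [inner_smul_right, RingHom.id_apply]
    module

variable {a b}

theorem inner_rotLin_left (ha : ‖a‖ = 1) (hab : ⟪a, b⟫ = 0) (t : ℝ) (x : R4) :
    ⟪a, rotLin a b t x⟫ = Real.cos t * ⟪a, x⟫ - Real.sin t * ⟪b, x⟫ := by
  simp only [rotLin, LinearMap.coe_mk, AddHom.coe_mk, inner_add_right, inner_smul_right, hab,
    real_inner_self_eq_norm_sq, ha]
  ring

theorem inner_rotLin_right (hb : ‖b‖ = 1) (hab : ⟪a, b⟫ = 0) (t : ℝ) (x : R4) :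
    ⟪b, rotLin a b t x⟫ = Real.cos t * ⟪b, x⟫ + Real.sin t * ⟪a, x⟫ := by
  simp only [rotLin, LinearMap.coe_mk, AddHom.coe_mk, inner_add_right, inner_smul_right,
    real_inner_comm a b, hab, real_inner_self_eq_norm_sq, hb]
  ring

theorem norm_rotLin (ha : ‖a‖ = 1) (hb : ‖b‖ = 1) (hab : ⟪a, b⟫ = 0) (t : ℝ) (x : R4) :
    ‖rotLin a b t x‖ = ‖x‖ := by
  have h : ‖rotLin a b t x‖ ^ 2 = ‖x‖ ^ 2 := by
    rw [← real_inner_self_eq_norm_sq, ← real_inner_self_eq_norm_sq]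
    nth_rewrite 1 [rotLin]
    simp only [LinearMap.coe_mk, AddHom.coe_mk, inner_add_left, inner_smul_left,
      inner_rotLin_left ha hab, inner_rotLin_right hb hab]
    have hx : ⟪x, rotLin a b t x⟫ = ⟪x, x⟫ +
        ((Real.cos t - 1) * ⟪a, x⟫ - Real.sin t * ⟪b, x⟫) * ⟪a, x⟫ +
        ((Real.cos t - 1) * ⟪b, x⟫ + Real.sin t * ⟪a, x⟫) * ⟪b, x⟫ := by
      simp only [rotLin, LinearMap.coe_mk, AddHom.coe_mk, inner_add_right, inner_smul_right,
        real_inner_comm]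
    rw [hx]
    simp only [conj_trivial]
    linear_combination (⟪a, x⟫ ^ 2 + ⟪b, x⟫ ^ 2) * Real.sin_sq_add_cos_sq t
  exact (sq_eq_sq₀ (norm_nonneg _) (norm_nonneg _)).1 h

/-- The rotation `rotLin` as a linear isometry. -/
def rotIsom (ha : ‖a‖ = 1) (hb : ‖b‖ = 1) (hab : ⟪a, b⟫ = 0) (t : ℝ) : R4 ≃ₗᵢ[ℝ] R4 :=
  LinearIsometry.toLinearIsometryEquiv ⟨rotLin a b t, norm_rotLin ha hb hab t⟩ rfl

theorem hasDerivAt_rotLin (ha : ‖a‖ = 1) (hb : ‖b‖ = 1) (hab : ⟪a, b⟫ = 0) (t : ℝ) (x : R4) :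
    HasDerivAt (fun t => rotLin a b t x)
      (⟪a, rotLin a b t x⟫ • b - ⟪b, rotLin a b t x⟫ • a) t := by
  rw [inner_rotLin_left ha hab, inner_rotLin_right hb hab]
  simp only [rotLin, LinearMap.coe_mk, AddHom.coe_mk]
  have hc := Real.hasDerivAt_cos t
  have hs := Real.hasDerivAt_sin t
  have h1 := (((hc.sub_const 1).mul_const ⟪a, x⟫).sub (hs.mul_const ⟪b, x⟫)).smul_const a
  have h2 := (((hc.sub_const 1).mul_const ⟪b, x⟫).add (hs.mul_const ⟪a, x⟫)).smul_const b
  have h := (h1.const_add x).add h2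
  refine h.congr_deriv ?_
  module

/-- Infinitesimal rotation invariance of the surface measure. -/
theorem integral_infinitesimal_rotation (ha : ‖a‖ = 1) (hb : ‖b‖ = 1) (hab : ⟪a, b⟫ = 0)
    {F : R4 → ℝ} {F' : R4 → R4 →L[ℝ] ℝ} (hF : ∀ x : S3, HasFDerivAt F (F' x) x)
    (hF' : Continuous fun x : S3 => F' x) :
    ∫ x : S3, F' x (⟪a, (x : R4)⟫ • b - ⟪b, (x : R4)⟫ • a) ∂surf = 0 := by
  have hFc : Continuous fun x : S3 => F x :=
    continuous_iff_continuousAt.2 fun x =>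
      (hF x).continuousAt.comp continuous_subtype_val.continuousAt
  obtain ⟨M, hM⟩ := (isCompact_range hF'.norm).bddAbove
  have hM' : ∀ x : S3, ‖F' x‖ ≤ M := fun x => hM ⟨x, rfl⟩
  set G' : ℝ → S3 → ℝ := fun t x =>
    F' (rotLin a b t x) (⟪a, rotLin a b t x⟫ • b - ⟪b, rotLin a b t x⟫ • a) with hG'
  have hcont : Continuous fun x : S3 => F' x (⟪a, (x : R4)⟫ • b - ⟪b, (x : R4)⟫ • a) :=
    hF'.clm_apply (by fun_prop)
  have hrot0 : ∀ x : R4, rotLin a b 0 x = x := fun x => by simp [rotLin]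
  have hmem : ∀ (t : ℝ) (x : S3), ∃ y : S3, (y : R4) = rotLin a b t x := fun t x =>
    ⟨⟨rotLin a b t x, by simp [norm_rotLin ha hb hab]⟩, rfl⟩
  have key := hasDerivAt_integral_of_dominated_loc_of_deriv_le (μ := surf) (x₀ := (0 : ℝ))
    (s := Set.univ) (F := fun t (x : S3) => F (rotLin a b t x)) (F' := G')
    -- On the unit sphere the rotation field ⟪a, x⟫b - ⟪b, x⟫a has norm at most 2.
    (bound := fun _ => M * 2) Filter.univ_mem
    (Filter.Eventually.of_forall fun t =>
      (hFc.comp (continuous_sphereMap (rotIsom ha hb hab t))).aestronglyMeasurable)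
    (by simpa only [hrot0] using integrable_of_continuous hFc)
    (by simpa only [hG', hrot0] using hcont.aestronglyMeasurable)
    (Filter.Eventually.of_forall fun x t _ => by
      obtain ⟨y, hy⟩ := hmem t x
      simp only [hG', ← hy]
      have h1 : ∀ c : R4, ‖c‖ = 1 → ‖⟪c, (y : R4)⟫‖ ≤ 1 := fun c hc =>
        (norm_inner_le_norm _ _).trans (by rw [hc, norm_coe_S3, one_mul])
      refine (ContinuousLinearMap.le_opNorm _ _).trans ?_
      refine mul_le_mul (hM' y) ?_ (norm_nonneg _) ((norm_nonneg _).trans (hM' y))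
      refine (norm_sub_le _ _).trans ?_
      rw [norm_smul, norm_smul, ha, hb]
      linarith [h1 a ha, h1 b hb])
    (integrable_const _)
    (Filter.Eventually.of_forall fun x t _ => by
      obtain ⟨y, hy⟩ := hmem t x
      have h1 := hF y
      rw [hy] at h1
      exact h1.comp_hasDerivAt t (hasDerivAt_rotLin ha hb hab t x))
  have hconst : (fun t => ∫ x : S3, F (rotLin a b t x) ∂surf) =
      fun _ => ∫ x : S3, F x ∂surf := by
    funext t
    exact integral_comp_isometry (rotIsom ha hb hab t) hFc
  have h0 := key.2
  rw [hconst] at h0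
  have := h0.unique (hasDerivAt_const _ _)
  simpa only [hG', hrot0] using this

end Rotation

/-! ### Divergence theorem on the sphere -/

/-- The divergence theorem on the sphere for the tangential part of the field `κ • eⱼ`. -/
theorem integral_tangential_div_single (j : Fin 4) {κ : R4 → ℝ} {κ' : R4 → R4 →L[ℝ] ℝ}
    (hκ : ∀ x : S3, HasFDerivAt κ (κ' x) x) (hκ' : Continuous fun x : S3 => κ' x) :
    ∫ x : S3, (κ' x (EuclideanSpace.single j 1) - (x : R4) j * κ' x x -
      3 * (x : R4) j * κ x) ∂surf = 0 := by
  have hc : Continuous fun x : S3 => κ x :=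
    continuous_iff_continuousAt.2 fun x =>
      (hκ x).continuousAt.comp continuous_subtype_val.continuousAt
  set e : Fin 4 → R4 := fun i => EuclideanSpace.single i (1 : ℝ) with he
  have hei : ∀ (i : Fin 4) (x : R4), ⟪e i, x⟫ = x i := fun i x => by
    simp [he, EuclideanSpace.inner_single_left]
  -- Rotation invariance in the (i, j) plane is applied to xᵢκ and summed over i. By ∑ xᵢ² = 1, the
  -- rotation fields weighted by xᵢ add up to the tangential part of eⱼ, and the terms from
  -- differentiating xᵢ give xⱼκ - 4xⱼκ = -3xⱼκ.
  set F' : Fin 4 → R4 → R4 →L[ℝ] ℝ := fun i x =>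
    x i • κ' x + κ x • EuclideanSpace.proj i with hF'
  have hF : ∀ (i : Fin 4) (x : S3), HasFDerivAt (fun y : R4 => y i * κ y) (F' i x) x :=
    fun i x => by
      have := (EuclideanSpace.proj (𝕜 := ℝ) i).hasFDerivAt (x := (x : R4)) |>.mul (hκ x)
      exact this
  have hFc : ∀ i, Continuous fun x : S3 => F' i x := fun i => by
    have h1 : Continuous fun x : S3 => (x : R4) i := by fun_prop
    exact (h1.smul hκ').add (hc.smul continuous_const)
  have hint : ∀ i, ∫ x : S3, F' i x ((x : R4) i • e j - (x : R4) j • e i) ∂surf = 0 := by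
    intro i
    by_cases hij : i = j
    · subst hij
      simp
    · have := integral_infinitesimal_rotation (a := e i) (b := e j) (by simp [he]) (by simp [he])
        (by rw [hei]; simp [he, hij]) (hF i) (hFc i)
      simpa only [hei] using this
  have hsum := Finset.sum_congr rfl fun i (_ : i ∈ Finset.univ) => hint i
  rw [Finset.sum_const_zero, ← integral_finsetSum] at hsum
  · rw [← hsum]
    refine integral_congr_ae (Filter.Eventually.of_forall fun x => ?_)
    have hx : ∑ i, (x : R4) i • e i = (x : R4) := by
      ext k
      simp [he, Finset.sum_apply, Pi.single_apply]
    have h1 : κ' x x = ∑ i, (x : R4) i * κ' x (e i) := by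
      conv_lhs => rw [← congrArg (κ' x) hx]
      simp only [map_sum, map_smul, smul_eq_mul]
    have h2 := sum_sq_S3 x
    have h3 : ∀ i, F' i x ((x : R4) i • e j - (x : R4) j • e i) =
        (x : R4) i ^ 2 * κ' x (e j) - (x : R4) j * ((x : R4) i * κ' x (e i)) +
          κ x * ((x : R4) i * e j i) - κ x * (x : R4) j := fun i => by
      have h4 : e i i = 1 := by simp [he]
      have h5 : F' i x ((x : R4) i • e j - (x : R4) j • e i) =
          (x : R4) i * κ' x ((x : R4) i • e j - (x : R4) j • e i) +
            κ x * ((x : R4) i * e j i - (x : R4) j * e i i) := rfl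
      rw [h5, map_sub, map_smul, map_smul, h4, smul_eq_mul, smul_eq_mul]
      ring
    have h6 : ∑ i, (x : R4) i * e j i = (x : R4) j := by
      simp [he]
    simp only [h3, Finset.sum_sub_distrib, Finset.sum_add_distrib, ← Finset.mul_sum,
      ← Finset.sum_mul, h2, h6, h1, Finset.sum_const, Finset.card_univ, Fintype.card_fin]
    simp only [he, nsmul_eq_mul]
    push_cast
    ring
  · intro i _
    refine integrable_of_continuous ((hFc i).clm_apply ?_)
    fun_prop

theorem sum_smul_single (v : R4) : ∑ i, v i • EuclideanSpace.single i (1 : ℝ) = v := by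
  ext k
  simp [Finset.sum_apply, Pi.single_apply]

theorem continuous_of_hasFDerivAt {κ : R4 → ℝ} {κ' : R4 → R4 →L[ℝ] ℝ}
    (hκ : ∀ x : S3, HasFDerivAt κ (κ' x) x) : Continuous fun x : S3 => κ x :=
  continuous_iff_continuousAt.2 fun x =>
    (hκ x).continuousAt.comp continuous_subtype_val.continuousAt

/-- The divergence theorem on the sphere for the tangential part of the field `κ • v`. -/
theorem integral_tangential_div_const (v : R4) {κ : R4 → ℝ} {κ' : R4 → R4 →L[ℝ] ℝ}
    (hκ : ∀ x : S3, HasFDerivAt κ (κ' x) x) (hκ' : Continuous fun x : S3 => κ' x) :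
    ∫ x : S3, (κ' x v - ⟪v, (x : R4)⟫ * κ' x x - 3 * ⟪v, (x : R4)⟫ * κ x) ∂surf = 0 := by
  have hc := continuous_of_hasFDerivAt hκ
  have h := Finset.sum_congr rfl fun j (_ : j ∈ Finset.univ) =>
    congrArg (v j * ·) (integral_tangential_div_single j hκ hκ')
  simp only [mul_zero, Finset.sum_const_zero, ← integral_const_mul] at h
  rw [← integral_finsetSum] at h
  · rw [← h]
    refine integral_congr_ae (Filter.Eventually.of_forall fun x => ?_)
    have h1 : κ' x v = ∑ j, v j * κ' x (EuclideanSpace.single j 1) := by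
      conv_lhs => rw [← sum_smul_single v]
      simp only [map_sum, map_smul, smul_eq_mul]
    have h2 : ⟪v, (x : R4)⟫ = ∑ j, v j * (x : R4) j := by
      simp [PiLp.inner_apply, mul_comm]
    simp only [h1, h2, Finset.sum_mul, Finset.mul_sum, ← Finset.sum_sub_distrib]
    refine Finset.sum_congr rfl fun j _ => ?_
    ring
  · intro j _
    refine integrable_of_continuous ?_
    have h1 : Continuous fun x : S3 => κ' x x := hκ'.clm_apply continuous_subtype_val
    have h2 : Continuous fun x : S3 => κ' x (EuclideanSpace.single j 1) :=
      hκ'.clm_apply continuous_const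
    have h3 : Continuous fun x : S3 => (x : R4) j := by fun_prop
    exact continuous_const.mul ((h2.sub (h3.mul h1)).sub ((continuous_const.mul h3).mul hc))

/-! ### Differential calculus of real parts of polynomials -/

/-- The real part of a complex polynomial, as a function on `ℝ⁴`. -/
def reEval (p : MvPolynomial (Fin 4) ℂ) (x : R4) : ℝ :=
  (MvPolynomial.eval (fun i => ((x i : ℝ) : ℂ)) p).re

/-- The gradient of `reEval p`. -/
def reGrad (p : MvPolynomial (Fin 4) ℂ) (x : R4) : R4 :=
  WithLp.toLp 2 fun i => reEval (MvPolynomial.pderiv i p) x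

theorem reGrad_apply (p : MvPolynomial (Fin 4) ℂ) (x : R4) (i : Fin 4) :
    reGrad p x i = reEval (MvPolynomial.pderiv i p) x := rfl

theorem continuous_reEval (p : MvPolynomial (Fin 4) ℂ) : Continuous (reEval p) :=
  Complex.continuous_re.comp ((MvPolynomial.continuous_eval p).comp (by fun_prop))

theorem continuous_reGrad (p : MvPolynomial (Fin 4) ℂ) : Continuous (reGrad p) := by
  unfold reGrad
  have := fun i => continuous_reEval (MvPolynomial.pderiv i p)
  fun_prop

theorem hasFDerivAt_eval (p : MvPolynomial (Fin 4) ℂ) (x : R4) :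
    HasFDerivAt (fun y : R4 => MvPolynomial.eval (fun i => ((y i : ℝ) : ℂ)) p)
      (∑ i, MvPolynomial.eval (fun i => ((x i : ℝ) : ℂ)) (MvPolynomial.pderiv i p) •
        (Complex.ofRealCLM ∘L EuclideanSpace.proj (𝕜 := ℝ) (ι := Fin 4) i)) x := by
  induction p using MvPolynomial.induction_on with
  | C a =>
    simp only [MvPolynomial.eval_C]
    refine (hasFDerivAt_const a x).congr_fderiv ?_
    ext v
    simp
  | add p q hp hq =>
    simp only [map_add]
    refine (hp.add hq).congr_fderiv ?_
    ext v
    simp [add_mul, Finset.sum_add_distrib]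
  | mul_X p k hp =>
    have hk : HasFDerivAt (fun y : R4 => ((y k : ℝ) : ℂ))
        (Complex.ofRealCLM ∘L EuclideanSpace.proj (𝕜 := ℝ) (ι := Fin 4) k) x :=
      (Complex.ofRealCLM ∘L
        EuclideanSpace.proj (𝕜 := ℝ) (ι := Fin 4) k).hasFDerivAt
    have h := hp.mul hk
    simp only [map_mul, MvPolynomial.eval_X]
    refine h.congr_fderiv ?_
    ext v
    have h1 : ∀ i, MvPolynomial.eval (fun i => ((x i : ℝ) : ℂ))
        (Pi.single (M := fun _ => MvPolynomial (Fin 4) ℂ) i 1 k) = if k = i then 1 else 0 :=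
      fun i => by
        rw [Pi.single_apply]
        split_ifs <;> simp
    simp [MvPolynomial.pderiv_X, add_mul, Finset.sum_add_distrib, h1, Finset.mul_sum]
    refine Finset.sum_congr rfl fun i _ => ?_
    ring

theorem hasFDerivAt_reEval (p : MvPolynomial (Fin 4) ℂ) (x : R4) :
    HasFDerivAt (reEval p) (innerSL ℝ (reGrad p x)) x := by
  have h := Complex.reCLM.hasFDerivAt.comp x (hasFDerivAt_eval p x)
  refine h.congr_fderiv ?_
  ext v
  simp [reGrad, reEval, PiLp.inner_apply, mul_comm]

/-- The Hessian of `reEval p`, applied to a vector. -/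
def reHess (p : MvPolynomial (Fin 4) ℂ) (x v : R4) : R4 :=
  WithLp.toLp 2 fun i => ⟪reGrad (MvPolynomial.pderiv i p) x, v⟫

theorem reHess_apply (p : MvPolynomial (Fin 4) ℂ) (x v : R4) (i : Fin 4) :
    reHess p x v i = ⟪reGrad (MvPolynomial.pderiv i p) x, v⟫ := rfl

theorem inner_eq_sum (v w : R4) : ⟪v, w⟫ = ∑ i, v i * w i := by
  simp [PiLp.inner_apply, mul_comm]

/-- The commutator of two derivations is a derivation, and this one kills the variables. -/
theorem pderiv_comm (i j : Fin 4) (p : MvPolynomial (Fin 4) ℂ) :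
    MvPolynomial.pderiv i (MvPolynomial.pderiv j p) =
      MvPolynomial.pderiv j (MvPolynomial.pderiv i p) := by
  have h : ⁅(MvPolynomial.pderiv i : Derivation ℂ (MvPolynomial (Fin 4) ℂ) _),
      (MvPolynomial.pderiv j : Derivation ℂ (MvPolynomial (Fin 4) ℂ) _)⁆ = 0 := by
    refine MvPolynomial.derivation_ext fun k => ?_
    rw [Derivation.commutator_apply, MvPolynomial.pderiv_X, MvPolynomial.pderiv_X]
    rcases eq_or_ne k i with rfl | hi <;> rcases eq_or_ne k j with rfl | hj <;> simp [*]
  have h1 := congrArg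
    (fun D : Derivation ℂ (MvPolynomial (Fin 4) ℂ) (MvPolynomial (Fin 4) ℂ) => D p) h
  rw [Derivation.commutator_apply] at h1
  exact sub_eq_zero.1 h1

theorem inner_reHess_comm (p : MvPolynomial (Fin 4) ℂ) (x v w : R4) :
    ⟪v, reHess p x w⟫ = ⟪w, reHess p x v⟫ := by
  simp only [inner_eq_sum, reHess_apply, reGrad_apply, Finset.mul_sum]
  rw [Finset.sum_comm]
  refine Finset.sum_congr rfl fun i _ => Finset.sum_congr rfl fun j _ => ?_
  rw [pderiv_comm]
  ring

theorem inner_reGrad_self {p : MvPolynomial (Fin 4) ℂ} {d : ℕ} (hp : p.IsHomogeneous d)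
    (x : R4) : ⟪reGrad p x, x⟫ = d * reEval p x := by
  have h := congrArg (fun s => (MvPolynomial.eval (fun i => ((x i : ℝ) : ℂ)) s).re)
    hp.sum_X_mul_pderiv
  simpa [inner_eq_sum, reGrad, reEval, mul_comm] using h

/-- Euler's identity for the partial derivatives, which are homogeneous of degree d. -/
theorem reHess_self {p : MvPolynomial (Fin 4) ℂ} {d : ℕ} (hp : p.IsHomogeneous (d + 1))
    (x : R4) : reHess p x x = (d : ℝ) • reGrad p x := by
  ext i
  rw [reHess_apply, inner_reGrad_self (hp.pderiv (i := i))]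
  simp [reGrad_apply]

theorem trace_reHess {p : MvPolynomial (Fin 4) ℂ} {d : ℕ} (hp : p ∈ harmonicPoly d) (x : R4) :
    ∑ i, reEval (MvPolynomial.pderiv i (MvPolynomial.pderiv i p)) x = 0 := by
  have h : polyLaplacian p = 0 := hp.2
  have h1 := congrArg (fun s => (MvPolynomial.eval (fun i => ((x i : ℝ) : ℂ)) s).re) h
  simpa [polyLaplacian, reEval] using h1

theorem hasFDerivAt_reGrad_inner (p : MvPolynomial (Fin 4) ℂ) (v x : R4) :
    HasFDerivAt (fun y => ⟪v, reGrad p y⟫) (innerSL ℝ (reHess p x v)) x := by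
  have h : HasFDerivAt (fun y => ∑ i, v i * reGrad p y i)
      (∑ i, v i • innerSL ℝ (reGrad (MvPolynomial.pderiv i p) x)) x :=
    HasFDerivAt.fun_sum fun i _ => (hasFDerivAt_reEval (MvPolynomial.pderiv i p) x).const_mul (v i)
  simp only [← inner_eq_sum] at h
  refine h.congr_fderiv ?_
  ext w
  rw [innerSL_apply_apply, real_inner_comm, inner_reHess_comm, inner_eq_sum]
  simp [reHess_apply]

theorem hasFDerivAt_norm_reGrad_sq (p : MvPolynomial (Fin 4) ℂ) (x : R4) :
    HasFDerivAt (fun y => ⟪reGrad p y, reGrad p y⟫)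
      (innerSL ℝ ((2 : ℝ) • reHess p x (reGrad p x))) x := by
  have h : HasFDerivAt (fun y => ∑ i, reGrad p y i * reGrad p y i)
      (∑ i, (reGrad p x i • innerSL ℝ (reGrad (MvPolynomial.pderiv i p) x) +
        reGrad p x i • innerSL ℝ (reGrad (MvPolynomial.pderiv i p) x))) x :=
    HasFDerivAt.fun_sum fun i _ => (hasFDerivAt_reEval (MvPolynomial.pderiv i p) x).mul
      (hasFDerivAt_reEval (MvPolynomial.pderiv i p) x)
  simp only [← inner_eq_sum] at h
  refine h.congr_fderiv ?_
  ext w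
  rw [innerSL_apply_apply, inner_smul_left, real_inner_comm, inner_reHess_comm, inner_eq_sum]
  simp [reHess_apply, Finset.sum_add_distrib, two_mul]

theorem continuous_reHess (p : MvPolynomial (Fin 4) ℂ) {α : Type*} [TopologicalSpace α]
    {a b : α → R4} (ha : Continuous a) (hb : Continuous b) :
    Continuous fun t => reHess p (a t) (b t) := by
  unfold reHess
  have h : ∀ i, Continuous fun t => reGrad (MvPolynomial.pderiv i p) (a t) := fun i =>
    (continuous_reGrad _).comp ha
  fun_prop

/-! ### Green's formula and the virial identity -/

/-- Green's formula on the sphere for a spherical harmonic `reEval p` and a function `h`. -/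
theorem integral_green {p : MvPolynomial (Fin 4) ℂ} {d : ℕ} (hp : p ∈ harmonicPoly (d + 1))
    {h : R4 → ℝ} {h' : R4 → R4 →L[ℝ] ℝ}
    (hh : ∀ x : S3, HasFDerivAt h (h' x) x) (hh' : Continuous fun x : S3 => h' x) :
    ∫ x : S3, (h' x (reGrad p x) - (d + 1) * reEval p x * h' x x -
      (d + 1) * (d + 3) * reEval p x * h x) ∂surf = 0 := by
  have hc := continuous_of_hasFDerivAt hh
  have hhom : p.IsHomogeneous (d + 1) := (MvPolynomial.mem_homogeneousSubmodule _ p).1 hp.1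
  -- The divergence theorem is applied to the field h∇p, one coordinate at a time; harmonicity
  -- removes the trace of the Hessian.
  set κ' : Fin 4 → R4 → R4 →L[ℝ] ℝ := fun j x =>
    h x • innerSL ℝ (reGrad (MvPolynomial.pderiv j p) x) + reGrad p x j • h' x with hκ'
  have hκ : ∀ (j : Fin 4) (x : S3), HasFDerivAt (fun y => h y * reGrad p y j) (κ' j x) x :=
    fun j x => (hh x).mul (hasFDerivAt_reEval (MvPolynomial.pderiv j p) x)
  have hg : ∀ q, Continuous fun x : S3 => reGrad q x := fun q =>
    (continuous_reGrad q).comp continuous_subtype_val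
  have hgj : ∀ j, Continuous fun x : S3 => reGrad p x j := fun j =>
    (continuous_reEval (MvPolynomial.pderiv j p)).comp continuous_subtype_val
  have hκc : ∀ j, Continuous fun x : S3 => κ' j x := fun j =>
    (hc.smul ((innerSL ℝ).continuous.comp (hg (MvPolynomial.pderiv j p)))).add ((hgj j).smul hh')
  have hsum := Finset.sum_congr rfl fun j (_ : j ∈ Finset.univ) =>
    integral_tangential_div_single j (hκ j) (hκc j)
  rw [Finset.sum_const_zero, ← integral_finsetSum] at hsum
  · rw [← hsum]
    refine integral_congr_ae (Filter.Eventually.of_forall fun x => ?_)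
    have h1 : h' x (reGrad p x) = ∑ j, reGrad p x j * h' x (EuclideanSpace.single j 1) := by
      conv_lhs => rw [← sum_smul_single (reGrad p x)]
      simp only [map_sum, map_smul, smul_eq_mul]
    have h2 := inner_reGrad_self hhom x
    rw [inner_eq_sum] at h2
    have h3 : ∀ j, ⟪reGrad (MvPolynomial.pderiv j p) x, (x : R4)⟫ = d * reGrad p x j := fun j =>
      congrArg (fun v : R4 => v j) (reHess_self hhom (x : R4))
    have h4 := trace_reHess hp (x : R4)
    have h5 : ∀ j, κ' j x (EuclideanSpace.single j 1) - (x : R4) j * κ' j x x -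
        3 * (x : R4) j * (h x * reGrad p x j) =
        h x * reEval (MvPolynomial.pderiv j (MvPolynomial.pderiv j p)) x +
        reGrad p x j * h' x (EuclideanSpace.single j 1) -
        ((d + 3) * h x + h' x x) * (reGrad p x j * (x : R4) j) := fun j => by
      have h6 : ⟪reGrad (MvPolynomial.pderiv j p) x, (EuclideanSpace.single j 1 : R4)⟫ =
          reEval (MvPolynomial.pderiv j (MvPolynomial.pderiv j p)) x := by
        simp [EuclideanSpace.inner_single_right, reGrad_apply]
      have h7 : ∀ v, κ' j x v = h x * ⟪reGrad (MvPolynomial.pderiv j p) x, v⟫ +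
        reGrad p x j * h' x v := fun v => rfl
      rw [h7, h7, h6, h3]
      ring
    simp only [h5, Finset.sum_sub_distrib, Finset.sum_add_distrib, ← Finset.mul_sum, h4, h2, h1]
    push_cast
    ring
  · intro j _
    refine integrable_of_continuous ?_
    have h1 : Continuous fun x : S3 => κ' j x x := (hκc j).clm_apply continuous_subtype_val
    have h2 : Continuous fun x : S3 => κ' j x (EuclideanSpace.single j 1) :=
      (hκc j).clm_apply continuous_const
    have h3 : Continuous fun x : S3 => (x : R4) j := by fun_prop
    exact (h2.sub (h3.mul h1)).sub ((continuous_const.mul h3).mul (hc.mul (hgj j)))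

theorem inner_S3_le_one {P : R4} (hP : ‖P‖ = 1) (x : S3) : ⟪P, (x : R4)⟫ ≤ 1 :=
  (real_inner_le_norm _ _).trans (by rw [hP, norm_coe_S3, one_mul])

/-- Continuity of the gradient `hv` used in `integral_virial`. -/
theorem continuous_smul_combination {α : Type*} [TopologicalSpace α] {g g' ρ f B : α → ℝ}
    {F H : α → R4} {P : R4} {c : ℝ} (hg : Continuous g) (hg' : Continuous g') (hρ : Continuous ρ)
    (hf : Continuous f) (hB : Continuous B) (hF : Continuous F) (hH : Continuous H) :
    Continuous fun x => g x • (-H x + c • (ρ x • F x + f x • P)) +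
      ((-B x + c * (ρ x * f x)) * g' x) • P := by
  fun_prop

/-- Continuity of the gradient `kv` used in `integral_virial`. -/
theorem continuous_smul_combination' {α : Type*} [TopologicalSpace α] {g g' g'' ρ f A : α → ℝ}
    {F H : α → R4} {P : R4} {a b : ℝ} (hg : Continuous g) (hg' : Continuous g')
    (hg'' : Continuous g'') (hρ : Continuous ρ) (hf : Continuous f) (hA : Continuous A)
    (hF : Continuous F) (hH : Continuous H) :
    Continuous fun x => g x • ((2 : ℝ) • H x - (a * f x) • F x) +
      ((A x - b * (f x * f x)) * g' x) • P -
      ((f x * f x * (2 * g' x + ρ x * g'' x)) • P + (2 * f x * (g x + ρ x * g' x)) • F x) := by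
  fun_prop

/-- The density in the virial identity for a spherical harmonic of degree `d + 1` and the vector
field `g(ρ) ∇ρ` with `ρ = ⟪P, x⟫`. -/
def virialDensity (P : R4) (g g' g'' : ℝ → ℝ) (p : MvPolynomial (Fin 4) ℂ) (d : ℕ) (x : R4) : ℝ :=
  (⟪P, x⟫ * g ⟪P, x⟫ + (1 - ⟪P, x⟫ ^ 2) * g' ⟪P, x⟫) *
      (⟪reGrad p x, reGrad p x⟫ - (d + 1) ^ 2 * reEval p x ^ 2) -
    2 * g' ⟪P, x⟫ * (⟪P, reGrad p x⟫ - ⟪P, x⟫ * ((d + 1) * reEval p x)) ^ 2 +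
    (⟪P, x⟫ * g ⟪P, x⟫ - (1 - ⟪P, x⟫ ^ 2) * g' ⟪P, x⟫) *
      ((d + 1) * (d + 3) * reEval p x ^ 2) -
    ((1 - ⟪P, x⟫ ^ 2) * (2 * g' ⟪P, x⟫ + ⟪P, x⟫ * g'' ⟪P, x⟫) -
      3 * ⟪P, x⟫ * (g ⟪P, x⟫ + ⟪P, x⟫ * g' ⟪P, x⟫)) * reEval p x ^ 2

set_option maxHeartbeats 1000000 in
/-- The virial (Pohozaev) identity for a spherical harmonic of degree `d + 1`. -/
theorem integral_virial {P : R4} (hP : ‖P‖ = 1) {g g' g'' : ℝ → ℝ}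
    (hg : ∀ s ≤ 1, HasDerivAt g (g' s) s) (hg' : ∀ s ≤ 1, HasDerivAt g' (g'' s) s)
    (hg'' : ContinuousOn g'' (Set.Iic 1)) {p : MvPolynomial (Fin 4) ℂ} {d : ℕ}
    (hp : p ∈ harmonicPoly (d + 1)) :
    Integrable (fun x : S3 => virialDensity P g g' g'' p d x) surf ∧
      ∫ x : S3, virialDensity P g g' g'' p d x ∂surf = 0 := by
  have hhom : p.IsHomogeneous (d + 1) := (MvPolynomial.mem_homogeneousSubmodule _ p).1 hp.1
  set ρ : R4 → ℝ := fun x => ⟪P, x⟫ with hρ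
  set f : R4 → ℝ := reEval p with hf
  set F : R4 → R4 := reGrad p with hF
  have hρ1 : ∀ x : S3, ρ x ≤ 1 := fun x => inner_S3_le_one hP x
  have dρ : ∀ x : R4, HasFDerivAt ρ (innerSL ℝ P) x := fun x => (innerSL ℝ P).hasFDerivAt
  have df : ∀ x : R4, HasFDerivAt f (innerSL ℝ (F x)) x := hasFDerivAt_reEval p
  have dB : ∀ x : R4, HasFDerivAt (fun y => ⟪P, F y⟫) (innerSL ℝ (reHess p x P)) x :=
    hasFDerivAt_reGrad_inner p P
  have dA : ∀ x : R4, HasFDerivAt (fun y => ⟪F y, F y⟫)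
      (innerSL ℝ ((2 : ℝ) • reHess p x (F x))) x := hasFDerivAt_norm_reGrad_sq p
  have dg : ∀ x : S3, HasFDerivAt (fun y => g (ρ y)) (g' (ρ x) • innerSL ℝ P) x := fun x =>
    (hg _ (hρ1 x)).comp_hasFDerivAt (x : R4) (dρ x)
  have dg' : ∀ x : S3, HasFDerivAt (fun y => g' (ρ y)) (g'' (ρ x) • innerSL ℝ P) x := fun x =>
    (hg' _ (hρ1 x)).comp_hasFDerivAt (x : R4) (dρ x)
  have cρ : Continuous fun x : S3 => ρ x := by fun_prop
  have cf : Continuous fun x : S3 => f x := (continuous_reEval p).comp continuous_subtype_val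
  have cF : Continuous fun x : S3 => F x := (continuous_reGrad p).comp continuous_subtype_val
  have cHP : Continuous fun x : S3 => reHess p x P :=
    continuous_reHess p continuous_subtype_val continuous_const
  have cHF : Continuous fun x : S3 => reHess p x (F x) :=
    continuous_reHess p continuous_subtype_val cF
  have cg : Continuous fun x : S3 => g (ρ x) := continuous_of_hasFDerivAt
    (κ := fun y => g (ρ y)) (κ' := fun y => g' (ρ y) • innerSL ℝ P) dg
  have cg' : Continuous fun x : S3 => g' (ρ x) := continuous_of_hasFDerivAt
    (κ := fun y => g' (ρ y)) (κ' := fun y => g'' (ρ y) • innerSL ℝ P) dg'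
  have cg'' : Continuous fun x : S3 => g'' (ρ x) := hg''.comp_continuous cρ hρ1
  have cB : Continuous fun x : S3 => ⟪P, F x⟫ := continuous_const.inner cF
  have cA : Continuous fun x : S3 => ⟪F x, F x⟫ := cF.inner cF
  -- On the sphere h = -Xf + ρgf: the tangential derivative of f along ∇ρ is ⟪P, F⟫ - (d + 1)ρf,
  -- which turns d + 1 into d + 2.
  set h : R4 → ℝ := fun x => g (ρ x) * (-⟪P, F x⟫ + (d + 2) * (ρ x * f x)) with hh
  set hv : R4 → R4 := fun x =>
    g (ρ x) • (-reHess p x P + ((d : ℝ) + 2) • (ρ x • F x + f x • P)) +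
      ((-⟪P, F x⟫ + (d + 2) * (ρ x * f x)) * g' (ρ x)) • P with hhv
  -- On the sphere k∇ρ = (|∇f|² - μf²)X - f²∇(ρg). Here |F|² = |∇f|² + (d + 1)²f² and (d + 1)² + μ =
  -- 2(d + 1)(d + 2).
  set k : R4 → ℝ := fun x => g (ρ x) * (⟪F x, F x⟫ - 2 * (d + 1) * (d + 2) * (f x * f x)) -
    f x * f x * (g (ρ x) + ρ x * g' (ρ x)) with hk
  set kv : R4 → R4 := fun x =>
    g (ρ x) • ((2 : ℝ) • reHess p x (F x) - (4 * ((d : ℝ) + 1) * (d + 2) * f x) • F x) +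
      ((⟪F x, F x⟫ - 2 * (d + 1) * (d + 2) * (f x * f x)) * g' (ρ x)) • P -
      ((f x * f x * (2 * g' (ρ x) + ρ x * g'' (ρ x))) • P +
        (2 * f x * (g (ρ x) + ρ x * g' (ρ x))) • F x) with hkv
  have dh : ∀ x : S3, HasFDerivAt h (innerSL ℝ (hv x)) x := fun x => by
    refine ((dg x).mul ((dB x).neg.add (((dρ x).mul (df x)).const_mul ((d : ℝ) + 2)))).congr_fderiv
      ?_
    ext w
    simp [hhv]
    ring
  have dk : ∀ x : S3, HasFDerivAt k (innerSL ℝ (kv x)) x := fun x => by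
    refine (((dg x).mul ((dA x).sub (((df x).mul (df x)).const_mul
      (2 * ((d : ℝ) + 1) * (d + 2))))).sub (((df x).mul (df x)).mul
        ((dg x).add ((dρ x).mul (dg' x))))).congr_fderiv ?_
    ext w
    simp [hkv]
    ring
  have ch : Continuous fun x : S3 => hv x := continuous_smul_combination cg cg' cρ cf cB cF cHP
  have ck : Continuous fun x : S3 => kv x :=
    continuous_smul_combination' cg cg' cg'' cρ cf cA cF cHF
  have i1 := integral_green hp (h' := fun x => innerSL ℝ (hv x)) dh
    ((innerSL ℝ).continuous.comp ch)
  have i2 := integral_tangential_div_const P (κ' := fun x => innerSL ℝ (kv x)) dk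
    ((innerSL ℝ).continuous.comp ck)
  have ch0 : Continuous fun x : S3 => h x :=
    continuous_of_hasFDerivAt (κ' := fun x => innerSL ℝ (hv x)) dh
  have ck0 : Continuous fun x : S3 => k x :=
    continuous_of_hasFDerivAt (κ' := fun x => innerSL ℝ (kv x)) dk
  have I1 : Integrable (fun x : S3 => 2 * (innerSL ℝ (hv x) (reGrad p x) -
      (d + 1) * reEval p x * innerSL ℝ (hv x) x - (d + 1) * (d + 3) * reEval p x * h x)) surf :=
    integrable_of_continuous (continuous_const.mul (((ch.inner cF).sub
      ((continuous_const.mul cf).mul (ch.inner continuous_subtype_val))).sub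
        ((continuous_const.mul cf).mul ch0)))
  have I2 : Integrable (fun x : S3 => innerSL ℝ (kv x) P - ⟪P, (x : R4)⟫ * innerSL ℝ (kv x) x -
      3 * ⟪P, (x : R4)⟫ * k x) surf :=
    integrable_of_continuous (((ck.inner continuous_const).sub
      (cρ.mul (ck.inner continuous_subtype_val))).sub ((continuous_const.mul cρ).mul ck0))
  -- With the factor 2 the second derivatives of p cancel, by symmetry of the Hessian; its values on
  -- x itself are given by Euler's identity.
  have hpt : (fun x : S3 => virialDensity P g g' g'' p d x) = fun x : S3 =>
      2 * (innerSL ℝ (hv x) (reGrad p x) -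
        (d + 1) * reEval p x * innerSL ℝ (hv x) x - (d + 1) * (d + 3) * reEval p x * h x) +
      (innerSL ℝ (kv x) P - ⟪P, (x : R4)⟫ * innerSL ℝ (kv x) x -
        3 * ⟪P, (x : R4)⟫ * k x) := by
    funext x
    have e1 : ⟪F x, (x : R4)⟫ = (d + 1) * f x := by
      have := inner_reGrad_self hhom x
      push_cast at this
      exact this
    have e2 : ⟪reHess p x P, (x : R4)⟫ = d * ⟪P, F x⟫ := by
      rw [real_inner_comm, inner_reHess_comm, reHess_self hhom, inner_smul_right]
    have e3 : ⟪reHess p x (F x), (x : R4)⟫ = d * ⟪F x, F x⟫ := by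
      rw [real_inner_comm, inner_reHess_comm, reHess_self hhom, inner_smul_right]
    have e4 : ⟪reHess p x (F x), P⟫ = ⟪reHess p x P, F x⟫ := by
      rw [real_inner_comm, inner_reHess_comm, real_inner_comm]
    have e5 : ⟪P, P⟫ = 1 := by rw [real_inner_self_eq_norm_sq, hP, one_pow]
    have e6 : ⟪F x, P⟫ = ⟪P, F x⟫ := real_inner_comm _ _
    have e7 : ⟪P, (x : R4)⟫ = ρ x := rfl
    have e8 : virialDensity P g g' g'' p d x =
        (ρ x * g (ρ x) + (1 - ρ x ^ 2) * g' (ρ x)) * (⟪F x, F x⟫ - (d + 1) ^ 2 * f x ^ 2) -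
        2 * g' (ρ x) * (⟪P, F x⟫ - ρ x * ((d + 1) * f x)) ^ 2 +
        (ρ x * g (ρ x) - (1 - ρ x ^ 2) * g' (ρ x)) * ((d + 1) * (d + 3) * f x ^ 2) -
        ((1 - ρ x ^ 2) * (2 * g' (ρ x) + ρ x * g'' (ρ x)) -
          3 * ρ x * (g (ρ x) + ρ x * g' (ρ x))) * f x ^ 2 := rfl
    rw [e8]
    simp only [innerSL_apply_apply, hhv, hkv, hh, hk, inner_add_left, inner_sub_left,
      inner_neg_left, inner_smul_left, conj_trivial, e1, e2, e3, e4, e5, e6, e7]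
    ring
  rw [hpt]
  refine ⟨I1.add I2, ?_⟩
  rw [integral_add I1 I2, integral_const_mul, i1, i2]
  simp

/-! ### Estimates for the weight r / √(r² + 1 - s) -/

section Weight

variable {r s T : ℝ}

theorem weight_arg_pos (hr : 0 < r) (hs : s ≤ 1) : 0 < r ^ 2 + 1 - s := by
  have := pow_pos hr 2
  linarith

theorem hasDerivAt_weight_sqrt (hr : 0 < r) (hs : s ≤ 1) :
    HasDerivAt (fun s => √(r ^ 2 + 1 - s)) (-(1 / (2 * √(r ^ 2 + 1 - s)))) s := by
  have h := ((hasDerivAt_id s).const_sub (r ^ 2 + 1)).sqrt (weight_arg_pos hr hs).ne'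
  refine h.congr_deriv ?_
  simp only [id]
  ring

theorem hasDerivAt_weight (hr : 0 < r) (hs : s ≤ 1) :
    HasDerivAt (fun s => r / √(r ^ 2 + 1 - s)) (r / (2 * √(r ^ 2 + 1 - s) ^ 3)) s := by
  have hT := Real.sqrt_pos.2 (weight_arg_pos hr hs)
  have h := (hasDerivAt_const s r).div (hasDerivAt_weight_sqrt hr hs) hT.ne'
  refine h.congr_deriv ?_
  field_simp
  ring

theorem hasDerivAt_weight' (hr : 0 < r) (hs : s ≤ 1) :
    HasDerivAt (fun s => r / (2 * √(r ^ 2 + 1 - s) ^ 3)) (3 * r / (4 * √(r ^ 2 + 1 - s) ^ 5)) s := by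
  have hT := Real.sqrt_pos.2 (weight_arg_pos hr hs)
  have h := (hasDerivAt_const s r).div (((hasDerivAt_weight_sqrt hr hs).pow 3).const_mul 2)
    (mul_pos two_pos (pow_pos hT 3)).ne'
  refine h.congr_deriv ?_
  simp only [Pi.pow_apply]
  field_simp
  ring

theorem continuousOn_weight'' (hr : 0 < r) :
    ContinuousOn (fun s => 3 * r / (4 * √(r ^ 2 + 1 - s) ^ 5)) (Set.Iic 1) := by
  refine ContinuousOn.div (by fun_prop) (by fun_prop) fun s hs => ?_
  have hT := Real.sqrt_pos.2 (weight_arg_pos hr hs)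
  positivity

theorem weight_le_two (hr1 : r ≤ 1) (hr : 0 < r) (hT : 0 < T) (hs : -1 ≤ s)
    (hTs : T ^ 2 = r ^ 2 + 1 - s) : T ≤ 2 := by
  nlinarith

/-- With σ = 1 - s, the left-hand numerator sT² - (1 - s²)/2 equals r² - σr² - σ²/2: the inverse
square root is chosen so that the term linear in σ cancels. The remaining loss is at most T⁴ ≤ 2T³.
-/
theorem radial_weight_lower (hr : 0 < r) (hr1 : r ≤ 1) (hT : 0 < T) (hs : -1 ≤ s) (hs1 : s ≤ 1)
    (hTs : T ^ 2 = r ^ 2 + 1 - s) :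
    r ^ 3 / T ^ 3 - 2 * r ≤ s * (r / T) - (1 - s ^ 2) * (r / (2 * T ^ 3)) := by
  have h2 := weight_le_two hr1 hr hT hs hTs
  have h3 : T ^ 4 ≤ 2 * T ^ 3 := by
    have := mul_le_mul_of_nonneg_left h2 (pow_pos hT 3).le
    linarith
  have h4 : s * (r / T) - (1 - s ^ 2) * (r / (2 * T ^ 3)) - (r ^ 3 / T ^ 3 - 2 * r) =
      r / T ^ 3 * (s * T ^ 2 - (1 - s ^ 2) / 2 - r ^ 2 + 2 * T ^ 3) := by
    field_simp
    ring
  have h5 : 0 ≤ s * T ^ 2 - (1 - s ^ 2) / 2 - r ^ 2 + 2 * T ^ 3 := by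
    have h6 : T ^ 4 = (r ^ 2 + 1 - s) ^ 2 := by rw [← hTs]; ring
    rw [hTs]
    nlinarith [mul_nonneg (sq_nonneg r) (sub_nonneg.2 hs1), sq_nonneg (1 - s), sq_nonneg (r ^ 2)]
  have h7 := mul_nonneg (div_pos hr (pow_pos hT 3)).le h5
  linarith

/-- The left-hand side is Δ(ρg) at ρ = s. After multiplication by T⁵/r and expansion in σ = 1 - s
and ε = r², the terms of degree one and two are nonpositive, and the cubic ones are at most 4T⁶ ≤
8T⁵. -/
theorem laplacian_weight_upper (hr : 0 < r) (hr1 : r ≤ 1) (hT : 0 < T) (hs : -1 ≤ s)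
    (hs1 : s ≤ 1) (hTs : T ^ 2 = r ^ 2 + 1 - s) :
    (1 - s ^ 2) * (2 * (r / (2 * T ^ 3)) + s * (3 * r / (4 * T ^ 5))) -
      3 * s * (r / T + s * (r / (2 * T ^ 3))) ≤ 8 * r := by
  have h2 := weight_le_two hr1 hr hT hs hTs
  have h3 : T ^ 6 ≤ 2 * T ^ 5 := by
    have := mul_le_mul_of_nonneg_left h2 (pow_pos hT 5).le
    linarith
  have h4 : 8 * r - ((1 - s ^ 2) * (2 * (r / (2 * T ^ 3)) + s * (3 * r / (4 * T ^ 5))) -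
      3 * s * (r / T + s * (r / (2 * T ^ 3)))) =
      r / T ^ 5 * (8 * T ^ 5 - ((1 - s ^ 2) * (T ^ 2 + 3 / 4 * s) -
        3 * s * T ^ 4 - 3 / 2 * s ^ 2 * T ^ 2)) := by
    field_simp
    ring
  have h5 : 0 ≤ 8 * T ^ 5 - ((1 - s ^ 2) * (T ^ 2 + 3 / 4 * s) -
        3 * s * T ^ 4 - 3 / 2 * s ^ 2 * T ^ 2) := by
    have h6 : T ^ 4 = (r ^ 2 + 1 - s) ^ 2 := by rw [← hTs]; ring
    have h7 : T ^ 6 = (r ^ 2 + 1 - s) ^ 3 := by rw [← hTs]; ring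
    rw [h7] at h3
    rw [hTs, h6]
    obtain ⟨σ, rfl⟩ : ∃ σ, s = 1 - σ := ⟨1 - s, by ring⟩
    obtain ⟨ε, hε⟩ : ∃ ε, ε = r ^ 2 := ⟨_, rfl⟩
    have hε0 : 0 ≤ ε := hε ▸ sq_nonneg r
    have hσ : 0 ≤ σ := by linarith
    rw [← hε] at h3 ⊢
    have h8 := mul_nonneg hε0 hσ
    have h9 := mul_nonneg h8 hσ
    have h10 := mul_nonneg h8 hε0
    have h11 := pow_nonneg hσ 3
    have h12 := pow_nonneg hε0 3
    nlinarith [sq_nonneg σ, sq_nonneg ε]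
  have h7 := mul_nonneg (div_pos hr (pow_pos hT 5)).le h5
  linarith

/-- Here G stands for |∇f|², D for the derivative of f along ∇ρ, m for μf² and u for f². Bounding D²
by (1 - s²)G gives G the same coefficient as m, and its part r³/T³ is nonnegative and dropped. -/
theorem virial_weight_lower (hr : 0 < r) (hr1 : r ≤ 1) (hT : 0 < T) (hs : -1 ≤ s) (hs1 : s ≤ 1)
    (hTs : T ^ 2 = r ^ 2 + 1 - s) {G D m u : ℝ} (hG : 0 ≤ G) (hD : D ^ 2 ≤ (1 - s ^ 2) * G)
    (hm : 0 ≤ m) (hu : 0 ≤ u) :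
    (r ^ 3 / T ^ 3 - 2 * r) * m - 2 * r * G - 8 * r * u ≤
      (s * (r / T) + (1 - s ^ 2) * (r / (2 * T ^ 3))) * G - 2 * (r / (2 * T ^ 3)) * D ^ 2 +
      (s * (r / T) - (1 - s ^ 2) * (r / (2 * T ^ 3))) * m -
      ((1 - s ^ 2) * (2 * (r / (2 * T ^ 3)) + s * (3 * r / (4 * T ^ 5))) -
        3 * s * (r / T + s * (r / (2 * T ^ 3)))) * u := by
  have h1 := radial_weight_lower hr hr1 hT hs hs1 hTs
  have h2 := mul_le_mul_of_nonneg_right h1 hm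
  have h3 := mul_le_mul_of_nonneg_right (laplacian_weight_upper hr hr1 hT hs hs1 hTs) hu
  have h4 := mul_le_mul_of_nonneg_right h1 hG
  have h5 := mul_le_mul_of_nonneg_left hD (show 0 ≤ 2 * (r / (2 * T ^ 3)) by positivity)
  have h6 : 0 ≤ r ^ 3 / T ^ 3 * G := by positivity
  nlinarith

theorem half_le_weight (hr : 0 < r) (hT : 0 < T) (hs : 1 - r ^ 2 / 2 ≤ s)
    (hTs : T ^ 2 = r ^ 2 + 1 - s) : 1 / 2 ≤ r ^ 3 / T ^ 3 := by
  -- T² ≤ 3r²/2 ≤ (5r/4)², and (4/5)³ = 64/125 exceeds 1/2.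
  have h1 : T ≤ 5 / 4 * r := by nlinarith
  have h2 : T ^ 3 ≤ (5 / 4 * r) ^ 3 := pow_le_pow_left₀ hT.le h1 3
  rw [le_div_iff₀ (pow_pos hT 3)]
  nlinarith [pow_pos hr 3]

end Weight

/-! ### Mass of a real spherical harmonic in a ball -/

theorem one_sub_le_inner_of_mem_geoBall {P x : S3} {r : ℝ} (hx : x ∈ geoBall P r) :
    1 - r ^ 2 / 2 ≤ ⟪(P : R4), (x : R4)⟫ := by
  have h1 : InnerProductGeometry.angle (P : R4) x < r := hx
  have h2 := InnerProductGeometry.angle_nonneg (P : R4) x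
  have h3 := Real.one_sub_sq_div_two_le_cos (x := InnerProductGeometry.angle (P : R4) x)
  rw [InnerProductGeometry.cos_angle, norm_coe_S3, norm_coe_S3, one_mul, div_one] at h3
  nlinarith

/-- Green's formula tested against the harmonic itself; the first two terms are the squared
tangential gradient. -/
theorem integral_gradient_sq {p : MvPolynomial (Fin 4) ℂ} {d : ℕ}
    (hp : p ∈ harmonicPoly (d + 1)) :
    ∫ x : S3, (⟪reGrad p x, reGrad p x⟫ - (d + 1) ^ 2 * reEval p x ^ 2 -
      (d + 1) * (d + 3) * reEval p x ^ 2) ∂surf = 0 := by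
  have hhom : p.IsHomogeneous (d + 1) := (MvPolynomial.mem_homogeneousSubmodule _ p).1 hp.1
  have h := integral_green hp (h' := fun x => innerSL ℝ (reGrad p x))
    (fun x => hasFDerivAt_reEval p x)
    ((innerSL ℝ).continuous.comp ((continuous_reGrad p).comp continuous_subtype_val))
  rw [← h]
  refine integral_congr_ae (Filter.Eventually.of_forall fun x => ?_)
  have e1 := inner_reGrad_self hhom x
  push_cast at e1
  simp only [innerSL_apply_apply, e1]
  ring

/-- The tangential gradient of a spherical harmonic controls its derivative towards `P`. -/
theorem radial_derivative_sq_le {P : R4} (hP : ‖P‖ = 1) {p : MvPolynomial (Fin 4) ℂ} {d : ℕ}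
    (hp : p.IsHomogeneous (d + 1)) (x : S3) :
    0 ≤ ⟪reGrad p x, reGrad p x⟫ - (d + 1) ^ 2 * reEval p x ^ 2 ∧
      (⟪P, reGrad p x⟫ - ⟪P, (x : R4)⟫ * ((d + 1) * reEval p x)) ^ 2 ≤
        (1 - ⟪P, (x : R4)⟫ ^ 2) *
          (⟪reGrad p x, reGrad p x⟫ - (d + 1) ^ 2 * reEval p x ^ 2) := by
  have e1 := inner_reGrad_self hp x
  push_cast at e1
  have e2 : ⟪(x : R4), reGrad p x⟫ = (d + 1) * reEval p x := by rw [real_inner_comm, e1]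
  have e3 : ⟪(x : R4), (x : R4)⟫ = 1 := by rw [real_inner_self_eq_norm_sq, norm_coe_S3, one_pow]
  have e4 : ⟪P, P⟫ = 1 := by rw [real_inner_self_eq_norm_sq, hP, one_pow]
  have e5 : ⟪(x : R4), P⟫ = ⟪P, (x : R4)⟫ := real_inner_comm _ _
  set v : R4 := P - ⟪P, (x : R4)⟫ • (x : R4) with hv
  set w : R4 := reGrad p x - ((d + 1) * reEval p x) • (x : R4) with hw
  have h1 : ⟪v, v⟫ = 1 - ⟪P, (x : R4)⟫ ^ 2 := by
    simp only [hv, inner_sub_left, inner_sub_right, inner_smul_left, inner_smul_right,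
      conj_trivial, e3, e4, e5]
    ring
  have h2 : ⟪w, w⟫ = ⟪reGrad p x, reGrad p x⟫ - (d + 1) ^ 2 * reEval p x ^ 2 := by
    simp only [hw, inner_sub_left, inner_sub_right, inner_smul_left, inner_smul_right,
      conj_trivial, e1, e2, e3]
    ring
  have h3 : ⟪v, w⟫ = ⟪P, reGrad p x⟫ - ⟪P, (x : R4)⟫ * ((d + 1) * reEval p x) := by
    simp only [hv, hw, inner_sub_left, inner_sub_right, inner_smul_left, inner_smul_right,
      conj_trivial, e2, e3]
    ring
  rw [← h1, ← h2, ← h3]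
  exact ⟨real_inner_self_nonneg, (sq _).trans_le (real_inner_mul_inner_self_le v w)⟩

/-- The mass of a real spherical harmonic of positive degree in a ball of radius `r` is `O(r)`. -/
theorem setIntegral_reEval_sq_le (P : S3) {r : ℝ} (hr : 0 < r) (hr1 : r ≤ 1)
    {p : MvPolynomial (Fin 4) ℂ} {d : ℕ} (hp : p ∈ harmonicPoly (d + 1)) :
    ∫ x in geoBall P r, reEval p x ^ 2 ∂surf ≤ 14 * r * ∫ x : S3, reEval p x ^ 2 ∂surf := by
  have hhom : p.IsHomogeneous (d + 1) := (MvPolynomial.mem_homogeneousSubmodule _ p).1 hp.1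
  have hP : ‖(P : R4)‖ = 1 := norm_coe_S3 P
  have hV := integral_virial hP (g := fun s => r / √(r ^ 2 + 1 - s))
    (g' := fun s => r / (2 * √(r ^ 2 + 1 - s) ^ 3))
    (g'' := fun s => 3 * r / (4 * √(r ^ 2 + 1 - s) ^ 5))
    (fun s hs => hasDerivAt_weight hr hs) (fun s hs => hasDerivAt_weight' hr hs)
    (continuousOn_weight'' hr) hp
  have hE := integral_gradient_sq hp
  set μ : ℝ := (d + 1) * (d + 3) with hμ
  have hμ3 : 3 ≤ μ := by
    have : (0 : ℝ) ≤ d := d.cast_nonneg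
    nlinarith
  have cf : Continuous fun x : S3 => reEval p x :=
    (continuous_reEval p).comp continuous_subtype_val
  have cF : Continuous fun x : S3 => reGrad p x :=
    (continuous_reGrad p).comp continuous_subtype_val
  have cA : Continuous fun x : S3 => ⟪reGrad p x, reGrad p x⟫ := cF.inner cF
  have if2 : Integrable (fun x : S3 => reEval p x ^ 2) surf := integrable_of_continuous (cf.pow 2)
  have iG : Integrable (fun x : S3 => ⟪reGrad p x, reGrad p x⟫ -
      (d + 1) ^ 2 * reEval p x ^ 2 - μ * reEval p x ^ 2) surf :=
    integrable_of_continuous (by fun_prop)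
  have iB := if2.indicator (measurableSet_geoBall P r)
  rw [← integral_indicator (measurableSet_geoBall P r)]
  set J : S3 → ℝ := (geoBall P r).indicator fun x => reEval p x ^ 2 with hJ
  -- Subtracting 2r(G - μf²), whose integral vanishes, trades the gradient loss 2rG for 2rμf²; with
  -- the loss 2rμf² already present this gives 4rμ.
  have key : ∀ x : S3, μ / 2 * J x - 2 * r * (⟪reGrad p x, reGrad p x⟫ -
      (d + 1) ^ 2 * reEval p x ^ 2 - μ * reEval p x ^ 2) - (4 * r * μ + 8 * r) * reEval p x ^ 2 ≤
      virialDensity P (fun s => r / √(r ^ 2 + 1 - s)) (fun s => r / (2 * √(r ^ 2 + 1 - s) ^ 3))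
        (fun s => 3 * r / (4 * √(r ^ 2 + 1 - s) ^ 5)) p d x := fun x => by
    have hs1 := inner_S3_le_one hP x
    have hs : -1 ≤ ⟪(P : R4), (x : R4)⟫ := by
      have := neg_le_of_abs_le (abs_real_inner_le_norm (P : R4) (x : R4))
      rwa [hP, norm_coe_S3, one_mul] at this
    have hT := Real.sqrt_pos.2 (weight_arg_pos hr hs1)
    have hTs := Real.sq_sqrt (weight_arg_pos hr hs1).le
    obtain ⟨hG, hD⟩ := radial_derivative_sq_le hP hhom x
    have hu := sq_nonneg (reEval p x)
    have hm : 0 ≤ μ * reEval p x ^ 2 := by positivity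
    refine le_trans ?_ (virial_weight_lower hr hr1 hT hs hs1 hTs hG hD hm hu)
    have hJx : 1 / 2 * (μ * J x) ≤
        r ^ 3 / √(r ^ 2 + 1 - ⟪(P : R4), (x : R4)⟫) ^ 3 * (μ * reEval p x ^ 2) := by
      by_cases hx : x ∈ geoBall P r
      · rw [hJ, Set.indicator_of_mem hx]
        exact mul_le_mul_of_nonneg_right
          (half_le_weight hr hT (one_sub_le_inner_of_mem_geoBall hx) hTs) hm
      · rw [hJ, Set.indicator_of_notMem hx, mul_zero, mul_zero]
        positivity
    linarith
  have hint := integral_mono (((iB.const_mul (μ / 2)).sub (iG.const_mul (2 * r))).sub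
    (if2.const_mul (4 * r * μ + 8 * r))) hV.1 key
  rw [hV.2] at hint
  have hsplit := integral_sub ((iB.const_mul (μ / 2)).sub (iG.const_mul (2 * r)))
    (if2.const_mul (4 * r * μ + 8 * r))
  have hsplit2 := integral_sub (iB.const_mul (μ / 2)) (iG.const_mul (2 * r))
  simp only [integral_const_mul, hE, mul_zero, sub_zero] at hsplit hsplit2
  have h0 : 0 ≤ ∫ x : S3, reEval p x ^ 2 ∂surf := integral_nonneg fun x => sq_nonneg _
  have hfin : μ / 2 * ∫ x, J x ∂surf ≤ (4 * r * μ + 8 * r) * ∫ x : S3, reEval p x ^ 2 ∂surf := by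
    have h1 := hsplit.symm.trans_le hint
    have h2 := hsplit2
    simp only [Pi.sub_apply] at h1 h2
    linarith
  -- Since μ ≥ 3, 8r ≤ 3rμ, so the total loss is at most 7rμ. Positive degree is essential here: μ
  -- vanishes on constants.
  have h5 : 4 * r * μ + 8 * r ≤ μ / 2 * (14 * r) := by nlinarith
  have h6 := hfin.trans (mul_le_mul_of_nonneg_right h5 h0)
  rw [mul_assoc] at h6
  exact le_of_mul_le_mul_left h6 (by positivity)

/-! ### Passage to operators on L² -/

theorem norm_sq_L2 (f : L2) : ‖f‖ ^ 2 = ∫ x, ‖f x‖ ^ 2 ∂surf := by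
  have h : ((‖f‖ ^ 2 : ℝ) : ℂ) = ((∫ x, ‖f x‖ ^ 2 ∂surf : ℝ) : ℂ) := by
    rw [← integral_complex_ofReal]
    have h1 := inner_self_eq_norm_sq_to_K (𝕜 := ℂ) f
    rw [L2.inner_def] at h1
    simp only [inner_self_eq_norm_sq_to_K] at h1
    push_cast
    exact h1.symm
  exact_mod_cast h

theorem norm_sq_ballCutoff (P : S3) (r : ℝ) (f : L2) :
    ‖ballCutoff P r f‖ ^ 2 = ∫ x in geoBall P r, ‖f x‖ ^ 2 ∂surf := by
  rw [norm_sq_L2, ← integral_indicator (measurableSet_geoBall P r)]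
  refine integral_congr_ae ?_
  filter_upwards [coeFn_indicatorMul (geoBall P r) (measurableSet_geoBall P r) f] with x hx
  have h : ballCutoff P r f x = (geoBall P r).indicator f x := hx
  rw [h]
  by_cases hm : x ∈ geoBall P r <;> simp [hm]

theorem norm_ballCutoff_apply_le (P : S3) (r : ℝ) (f : L2) : ‖ballCutoff P r f‖ ≤ ‖f‖ := by
  refine Lp.norm_le_norm_of_ae_le ?_
  filter_upwards [coeFn_indicatorMul (geoBall P r) (measurableSet_geoBall P r) f] with x h1
  exact (congrArg norm h1).trans_le (norm_indicator_le_norm_self _ _)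

theorem isSelfAdjoint_ballCutoff (P : S3) (r : ℝ) : IsSelfAdjoint (ballCutoff P r) := by
  rw [ContinuousLinearMap.isSelfAdjoint_iff_isSymmetric]
  intro f g
  change inner ℂ (ballCutoff P r f) g = inner ℂ f (ballCutoff P r g)
  rw [L2.inner_def, L2.inner_def]
  refine integral_congr_ae ?_
  filter_upwards [coeFn_indicatorMul (geoBall P r) (measurableSet_geoBall P r) f,
    coeFn_indicatorMul (geoBall P r) (measurableSet_geoBall P r) g] with x hf hg
  have h1 : ballCutoff P r f x = (geoBall P r).indicator f x := hf
  have h2 : ballCutoff P r g x = (geoBall P r).indicator g x := hg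
  simp only [h1, h2]
  by_cases hm : x ∈ geoBall P r <;> simp [hm]

theorem norm_comp_comm_of_isSelfAdjoint {A B : L2 →L[ℂ] L2} (hA : IsSelfAdjoint A)
    (hB : IsSelfAdjoint B) : ‖A ∘L B‖ = ‖B ∘L A‖ := by
  rw [← ContinuousLinearMap.adjoint.norm_map (A ∘L B), ContinuousLinearMap.adjoint_comp,
    hA.adjoint_eq, hB.adjoint_eq]

/-- The imaginary part of p is the real part of -ip, which is again harmonic and homogeneous, so the
real estimate applies to both parts. -/
theorem norm_polyRestrict_sq (p : MvPolynomial (Fin 4) ℂ) (x : S3) :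
    ‖polyRestrict p x‖ ^ 2 = reEval p x ^ 2 + reEval (-Complex.I • p) x ^ 2 := by
  have h : polyRestrict p x = MvPolynomial.eval (fun i => ((x.1 i : ℝ) : ℂ)) p := rfl
  rw [h, Complex.sq_norm, Complex.normSq_apply]
  simp [reEval, MvPolynomial.smul_eval]
  ring

/-- The mass of a spherical harmonic of positive degree in a ball of radius `r` is `O(r)`. -/
theorem norm_sq_ballCutoff_sphericalHarmonic_le (P : S3) {r : ℝ} (hr : 0 < r) (hr1 : r ≤ 1)
    {d : ℕ} {f : L2} (hf : f ∈ sphericalHarmonics (d + 1)) :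
    ‖ballCutoff P r f‖ ^ 2 ≤ 14 * r * ‖f‖ ^ 2 := by
  obtain ⟨p, hp, rfl⟩ := hf
  set f : L2 := ((ContinuousMap.toLp 2 surf ℂ).toLinearMap ∘ₗ polyRestrict) p with hf
  have hcoe : f =ᵐ[surf] polyRestrict p := ContinuousMap.coeFn_toLp (𝕜 := ℂ) surf (polyRestrict p)
  have hsq : (fun x => ‖f x‖ ^ 2) =ᵐ[surf]
      fun x => reEval p x ^ 2 + reEval (-Complex.I • p) x ^ 2 := by
    filter_upwards [hcoe] with x hx
    rw [hx, norm_polyRestrict_sq]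
  have hi : ∀ q, Integrable (fun x : S3 => reEval q x ^ 2) surf := fun q =>
    integrable_of_continuous (((continuous_reEval q).comp continuous_subtype_val).pow 2)
  rw [norm_sq_ballCutoff, norm_sq_L2, integral_congr_ae hsq,
    integral_congr_ae (ae_restrict_of_ae hsq), integral_add (hi _) (hi _),
    integral_add (hi _).integrableOn (hi _).integrableOn, mul_add]
  exact add_le_add (setIntegral_reEval_sq_le P hr hr1 hp)
    (setIntegral_reEval_sq_le P hr hr1 (Submodule.smul_mem _ _ hp))

theorem norm_ballCutoff_comp_spectralProj_le (P : S3) {r : ℝ} (hr : 0 < r) (hr1 : r ≤ 1)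
    {q : ℕ} (hq : 2 ≤ q) : ‖ballCutoff P r ∘L spectralProj q‖ ≤ 4 * √r := by
  refine ContinuousLinearMap.opNorm_le_bound _ (by positivity) fun f => ?_
  obtain ⟨d, rfl⟩ : ∃ d, q = d + 2 := ⟨q - 2, by omega⟩
  have hmem : spectralProj (d + 2) f ∈ sphericalHarmonics (d + 1) :=
    Submodule.starProjection_apply_mem _ f
  have h1 := norm_sq_ballCutoff_sphericalHarmonic_le P hr hr1 hmem
  have h2 : ‖spectralProj (d + 2) f‖ ≤ ‖f‖ := Submodule.norm_starProjection_apply_le _ f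
  have h3 : ‖spectralProj (d + 2) f‖ ^ 2 ≤ ‖f‖ ^ 2 := pow_le_pow_left₀ (norm_nonneg _) h2 2
  rw [ContinuousLinearMap.comp_apply]
  refine (sq_le_sq₀ (norm_nonneg _) (by positivity)).1 ?_
  rw [mul_pow, mul_pow, Real.sq_sqrt hr.le]
  -- The constant 4 comes from 14 ≤ 4².
  nlinarith [mul_le_mul_of_nonneg_left h3 hr.le, mul_nonneg hr.le (sq_nonneg ‖f‖)]

theorem norm_ballCutoff_comp_spectralProj_le_one (P : S3) (r : ℝ) (q : ℕ) :
    ‖ballCutoff P r ∘L spectralProj q‖ ≤ 1 := by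
  refine ContinuousLinearMap.opNorm_le_bound _ zero_le_one fun f => ?_
  rw [one_mul]
  exact (norm_ballCutoff_apply_le P r _).trans (Submodule.norm_starProjection_apply_le _ f)

end SphereCluster

end

theorem lemma2p3 :
    ∃ C : ℝ, 0 < C ∧ ∀ (N : ℕ), (∃ k : ℕ, N = 2 ^ k) → ∀ (P : SphereCluster.S3) (q : ℕ), 1 ≤ q →
      ‖SphereCluster.ballCutoff P (N : ℝ)⁻¹ ∘L SphereCluster.spectralProj q‖ =
          ‖SphereCluster.spectralProj q ∘L SphereCluster.ballCutoff P (N : ℝ)⁻¹‖ ∧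
        ‖SphereCluster.spectralProj q ∘L SphereCluster.ballCutoff P (N : ℝ)⁻¹‖ ≤
          C * ((N : ℝ) ^ (-(1 / 2) : ℝ) + (q : ℝ) ^ (-2 : ℝ)) := by
  refine ⟨4, by norm_num, fun N hN P q hq => ?_⟩
  have heq : ‖SphereCluster.ballCutoff P (N : ℝ)⁻¹ ∘L SphereCluster.spectralProj q‖ =
      ‖SphereCluster.spectralProj q ∘L SphereCluster.ballCutoff P (N : ℝ)⁻¹‖ :=
    SphereCluster.norm_comp_comm_of_isSelfAdjoint (SphereCluster.isSelfAdjoint_ballCutoff P _)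
      (isSelfAdjoint_starProjection _)
  refine ⟨heq, heq ▸ ?_⟩
  have hN1 : (1 : ℝ) ≤ N := by
    obtain ⟨k, rfl⟩ := hN
    exact_mod_cast Nat.one_le_two_pow
  have hN0 : (0 : ℝ) < N := by linarith
  have hA : 0 ≤ (N : ℝ) ^ (-(1 / 2) : ℝ) := by positivity
  have hB : 0 ≤ (q : ℝ) ^ (-2 : ℝ) := by positivity
  rcases Nat.lt_or_ge q 2 with h | h
  -- Constants: the only case in which the q⁻² term is needed.
  · obtain rfl : q = 1 := by omega
    have := SphereCluster.norm_ballCutoff_comp_spectralProj_le_one P (N : ℝ)⁻¹ 1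
    rw [Nat.cast_one, Real.one_rpow]
    linarith
  · have h1 := SphereCluster.norm_ballCutoff_comp_spectralProj_le P (inv_pos.2 hN0)
      (inv_le_one_of_one_le₀ hN1) h
    have h2 : √(N : ℝ)⁻¹ = (N : ℝ) ^ (-(1 / 2) : ℝ) := by
      rw [Real.rpow_neg hN0.le, ← Real.sqrt_eq_rpow, Real.sqrt_inv]
    rw [h2] at h1
    linarith
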